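/- Let $(\Omega,\rho)$ be a compact metric space, $\mu$ a Borel probability measure on $\Omega$, and $\mathcal F$ the $\mu$-completion of the Borel $\sigma$-algebra; measurable subsets of $\Omega$ and measurable functions on $\Omega$ refer to $\mathcal F$, and $\mathbb E(g)=\int_\Omega g\,d\mu$. Let $(T_x)_{x\in\mathbf R^d}$ be a group action of $\mathbf R^d$ on $\Omega$, that is, $T_0=\mathrm{Id}$ and $T_{x+y}=T_x\circ T_y$, and let $a(x,\omega)\in\mathbf R^{d\times d}$, $x\in\mathbf R^d$, $\omega\in\Omega$, be a random field (each $a(x,\cdot)$ is measurable). Assume that $(\Omega,\mathcal F,\mu)$ is the canonical space of $a$, in the sense that $\mathcal F$ is the $\mu$-completion of the $\sigma$-algebra generated by the variables $a(x,\cdot)$, $x\in\mathbf R^d$, and that: (H1) $(x,\omega)\mapsto T_x\omega$ is measurable from $\mathbf R^d\times\Omega$ (with the completion of the product $\sigma$-algebra with respect to the product of Lebesgue measure and $\mu$) into $\Omega$ with its Borel $\sigma$-algebra, and $a(y,T_x\omega)=a(x+y,\omega)$ for all $x,y\in\mathbf R^d$ and $\omega\in\Omega$; (H2) for all $x,y_1,\dots,y_k\in\mathbf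 R^d$ and every Borel set $B\subset(\mathbf R^{d\times d})^k$, $$\mu\{\omega:(a(y_1,T_x\omega),\dots,a(y_k,T_x\omega))\in B\}=\mu\{\omega:(a(y_1,\omega),\dots,a(y_k,\omega))\in B\};$$ (H3) if $A\in\mathcal F$ and, for every $x\in\mathbf R^d$, $T_xA=A$ up to a $\mu$-null set, then $\mu(A)\in\{0,1\}$; (H4) every $a(x,\omega)$ is symmetric, and there are $c_1,c_2>0$ with $c_1|\xi|^2\le\xi\cdot a(x,\omega)\xi\le c_2|\xi|^2$ for all $x,\xi\in\mathbf R^d$ and $\omega\in\Omega$; (H5') $\omega\mapsto a(0,\omega)$ is continuous on $\Omega$; and for every $\Phi\in L^1(\Omega,\mu)$, $\Phi\circ T_x\in L^1(\Omega,\mu)$ for all $x$, and $x\mapsto\Phi\circ T_x$ is continuous from $\mathbf R^d$ into $L^1(\Omega,\mu)$. Call $\omega\in\Omega$ a typical trajectory if, for every real-valued $g\in C(\Omega)$, the function $x\mapsto g(T_x\omega)$ is locally integrable on $\mathbf R^d$ and, for every bounded Borel set $A\subset\mathbf R^d$ with Lebesgue measure $|A|>0$, $$\lim_{t\to\infty}\frac1{t^d|A|}\int_{tA}g(T_x\omega)\,dx=\mathbb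 E(g).$$ Let $\widetilde\Omega$ be the set of typical trajectories. Then $\widetilde\Omega\in\mathcal F$ and $\mu(\widetilde\Omega)=1$. -/

import Mathlib

open MeasureTheory Filter Topology
open scoped Pointwise Matrix symmDiff

/-- The space `ℝᵈ` with its Euclidean norm and Lebesgue measure. -/
abbrev Rd (d : ℕ) : Type := EuclideanSpace ℝ (Fin d)

/-- Matrices carry their Borel `σ`-algebra, the product one over the entries. -/
instance matrixMeasurableSpace (d : ℕ) : MeasurableSpace (Matrix (Fin d) (Fin d) ℝ) :=
  inferInstanceAs (MeasurableSpace (Fin d → Fin d → ℝ))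

instance matrixBorelSpace (d : ℕ) : BorelSpace (Matrix (Fin d) (Fin d) ℝ) :=
  inferInstanceAs (BorelSpace (Fin d → Fin d → ℝ))

/-- The `σ`-algebra generated by all the random variables `a(x, ·)`, `x ∈ ℝᵈ`. -/
abbrev fieldSigmaAlgebra {d : ℕ} {Ω : Type*} (a : Rd d → Ω → Matrix (Fin d) (Fin d) ℝ) :
    MeasurableSpace Ω :=
  ⨆ x : Rd d, MeasurableSpace.comap (a x) inferInstance

/-- The standing assumptions on a stationary ergodic random field `a` of `d × d` matrices over
its canonical space, a compact metric space `Ω` with a Borel probability measure `μ`, and on the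
action `T` of `ℝᵈ` on `Ω` by translations.

The `σ`-algebra of events is the `μ`-completion of the Borel `σ`-algebra of `Ω`; the events are
therefore exactly the sets `A` with `NullMeasurableSet A μ`, and `NullMeasurable` is
measurability with respect to that complete `σ`-algebra. -/
structure IsStationaryErgodicField {d : ℕ} {Ω : Type*} [MetricSpace Ω] [CompactSpace Ω]
    [MeasurableSpace Ω] [BorelSpace Ω] (μ : Measure Ω) [IsProbabilityMeasure μ]
    (T : Rd d → Ω → Ω) (a : Rd d → Ω → Matrix (Fin d) (Fin d) ℝ) : Prop where
  /-- `T` is a group action of `ℝᵈ` on `Ω`. -/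
  map_zero : ∀ ω, T 0 ω = ω
  map_add : ∀ x y ω, T (x + y) ω = T x (T y ω)
  /-- `a` is a random field. -/
  measurable_field : ∀ x, NullMeasurable (a x) μ
  /-- The space is the canonical space of `a`: its `σ`-algebra of events is the completion of
  the one generated by `a`. -/
  canonical : ∀ A : Set Ω, NullMeasurableSet A μ →
    ∃ L U : Set Ω, MeasurableSet[fieldSigmaAlgebra a] L ∧ MeasurableSet[fieldSigmaAlgebra a] U ∧
      L ⊆ A ∧ A ⊆ U ∧ μ (U \ L) = 0
  /-- Compatibility: `(x, ω) ↦ T_x ω` is measurable (for the completed product `σ`-algebra), and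
  `a(y, T_x ω) = a(x + y, ω)`. -/
  measurable_action : NullMeasurable (fun p : Rd d × Ω => T p.1 p.2) (volume.prod μ)
  compatible : ∀ x y ω, a y (T x ω) = a (x + y) ω
  /-- Stationarity: the finite-dimensional laws of `a` are invariant under translations. -/
  stationary : ∀ (x : Rd d) (k : ℕ) (B : Set (Fin k → Matrix (Fin d) (Fin d) ℝ)),
    MeasurableSet B → ∀ y : Fin k → Rd d,
      μ {ω | (fun i => a (y i) (T x ω)) ∈ B} = μ {ω | (fun i => a (y i) ω) ∈ B}
  /-- Ergodicity: an event that is invariant, up to null sets, under all translations has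
  probability `0` or `1`. -/
  ergodic : ∀ A : Set Ω, NullMeasurableSet A μ → (∀ x, μ ((T x '' A) ∆ A) = 0) →
    μ A = 0 ∨ μ A = 1
  /-- The matrices are symmetric, uniformly bounded and uniformly elliptic. -/
  symmetric : ∀ x ω, (a x ω).IsSymm
  elliptic : ∃ c₁ c₂ : ℝ, 0 < c₁ ∧ 0 < c₂ ∧ ∀ (ω : Ω) (ξ : Fin d → ℝ) (x : Rd d),
    c₁ * (ξ ⬝ᵥ ξ) ≤ ξ ⬝ᵥ (a x ω *ᵥ ξ) ∧ ξ ⬝ᵥ (a x ω *ᵥ ξ) ≤ c₂ * (ξ ⬝ᵥ ξ)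
  /-- `ω ↦ a(0, ω)` is continuous on `Ω`. -/
  continuous_field : Continuous (a 0)
  /-- `x ↦ Φ ∘ T_x` is continuous from `ℝᵈ` into `L¹(Ω)` for every `Φ ∈ L¹(Ω)`. -/
  integrable_comp : ∀ Φ : Ω → ℝ, Integrable Φ μ → ∀ x, Integrable (fun ω => Φ (T x ω)) μ
  continuous_action : ∀ Φ : Ω → ℝ, Integrable Φ μ → ∀ x,
    Tendsto (fun y => ∫ ω, |Φ (T y ω) - Φ (T x ω)| ∂μ) (𝓝 x) (𝓝 0)

/-- The set of typical trajectories. The local integrability of `x ↦ g (T_x ω)`, without which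
the spatial averages have no meaning, is part of the definition. -/
def typicalTrajectories {d : ℕ} {Ω : Type*} [TopologicalSpace Ω] [MeasurableSpace Ω]
    (μ : Measure Ω) (T : Rd d → Ω → Ω) : Set Ω :=
  {ω | ∀ g : C(Ω, ℝ), LocallyIntegrable (fun x : Rd d => g (T x ω)) volume ∧
    ∀ A : Set (Rd d), MeasurableSet A → Bornology.IsBounded A → 0 < volume A →
      Tendsto (fun t : ℝ => (t ^ d * volume.real A)⁻¹ * ∫ x in t • A, g (T x ω))
        atTop (𝓝 (∫ ω', g ω' ∂μ))}

/-!
The conclusion is Wiener's pointwise ergodic theorem for an action of `ℝᵈ`, with an exceptional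
null set common to all continuous functions and all averaging sets.

The events are generated, up to null sets, by the field, and translation maps finite-dimensional
events of the field to finite-dimensional events, so by stationarity and a `π`-`λ` argument each
`T x` preserves `μ` (`IsStationaryErgodicField.isMeasurePreservingAction`).

Fix a bounded function `g`. The element of least norm of the closed convex hull of the translates
`g ∘ T y` in `L²` is invariant, so by ergodicity it is the constant `𝔼 g`. Hence there are finite
convex combinations `f` of translates of `g` with `f - 𝔼 g` arbitrarily small in `L¹`
(`IsMeasurePreservingAction.exists_mem_convexHull_lintegral_sub_le`). By Wiener's maximal
inequality (`IsMeasurePreservingAction.mul_measure_iUnion_maximalSet_le`), which is the Vitali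
covering lemma in `ℝᵈ` transferred to `Ω` along the orbits, the averages of `|f - 𝔼 g|` along the
orbit of `ω` over all balls of integer radius centred at the origin are then small, except on a set
of small measure. Thus for almost every `ω` such an `f` exists for every prescribed bound
(`IsMeasurePreservingAction.ae_exists_mem_convexHull_maximal_le`).

For such an `ω` and any bounded Borel set `A` of positive measure the averages of `g` and of `f`
over `t • A` have the same asymptotics, because `g` is bounded and `t • A` is almost invariant under
a fixed translation, and the average of `|f - 𝔼 g|` over `t • A` is at most a constant, depending on
`A` only, times an average over a ball (`tendsto_average_smul_set`). So the exceptional set does not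
depend on `A`. Since `C(Ω, ℝ)` is separable in the supremum norm, it can be chosen independently of
`g` as well (`IsMeasurePreservingAction.ae_mem_typicalTrajectories`).
-/

/-! ### A covering estimate for ball averages -/

open Metric Module in
/-- A weak-type estimate for the averages of one fixed function over balls of radius at most `R`,
obtained from the Vitali covering lemma. No measurability is needed: the set on the left enters
through its outer measure only. -/
theorem mul_measure_setOf_exists_lt_lintegral_closedBall_le {E : Type*} [NormedAddCommGroup E]
    [NormedSpace ℝ E] [FiniteDimensional ℝ E] [MeasurableSpace E] [BorelSpace E]
    (ν : Measure E) [ν.IsAddHaarMeasure] (φ : E → ENNReal) (s : Set E) (R : ℝ) (c : ENNReal) :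
    c * ν {x ∈ s | ∃ r : ℝ, 0 < r ∧ r ≤ R ∧ c * ν (closedBall x r) ≤ ∫⁻ y in closedBall x r, φ y ∂ν}
      ≤ ENNReal.ofReal (5 ^ finrank ℝ E) * ∫⁻ y in cthickening R s, φ y ∂ν := by
  set S := {x ∈ s | ∃ r : ℝ, 0 < r ∧ r ≤ R ∧
    c * ν (closedBall x r) ≤ ∫⁻ y in closedBall x r, φ y ∂ν}
  have hS' : ∀ x : E, ∃ r : ℝ, x ∈ S → 0 < r ∧ r ≤ R ∧
      c * ν (closedBall x r) ≤ ∫⁻ y in closedBall x r, φ y ∂ν := fun x => by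
    by_cases hx : x ∈ S
    · obtain ⟨r, hr⟩ := hx.2
      exact ⟨r, fun _ => hr⟩
    · exact ⟨0, fun h => absurd h hx⟩
  choose r hr using hS'
  obtain ⟨u, huS, hdisj, hcov⟩ := Vitali.exists_disjoint_subfamily_covering_enlargement_closedBall
    S id r R (fun a ha => (hr a ha).2.1) 5 (by norm_num)
  have hu : u.Countable := hdisj.countable_of_nonempty_interior fun a ha =>
    ⟨a, ball_subset_interior_closedBall (mem_ball_self (hr a (huS ha)).1)⟩
  have hsub : S ⊆ ⋃ b ∈ u, closedBall b (5 * r b) := fun a ha => by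
    obtain ⟨b, hb, hab⟩ := hcov a ha
    exact Set.mem_biUnion hb (hab (mem_closedBall_self (hr a ha).1.le))
  have hthick : ⋃ b ∈ u, closedBall b (r b) ⊆ cthickening R s := Set.iUnion₂_subset fun b hb =>
    (closedBall_subset_closedBall (hr b (huS hb)).2.1).trans
      (closedBall_subset_cthickening (huS hb).1 R)
  calc c * ν S ≤ c * ∑' b : u, ν (closedBall (b : E) (5 * r b)) := by
        gcongr
        exact (measure_mono hsub).trans (measure_biUnion_le ν hu _)
    _ = ENNReal.ofReal (5 ^ finrank ℝ E) * ∑' b : u, c * ν (closedBall (b : E) (r b)) := by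
        rw [ENNReal.tsum_mul_left, mul_left_comm]
        congr 1
        rw [← ENNReal.tsum_mul_left]
        refine tsum_congr fun b => ?_
        have hb := (hr b (huS b.2)).1.le
        rw [Measure.addHaar_closedBall_mul ν _ (by norm_num) hb,
          Measure.addHaar_closedBall_center ν (b : E)]
    _ ≤ ENNReal.ofReal (5 ^ finrank ℝ E) *
          ∑' b : u, ∫⁻ y in closedBall (b : E) (r b), φ y ∂ν := by
        gcongr with b
        exact (hr b (huS b.2)).2.2
    _ = ENNReal.ofReal (5 ^ finrank ℝ E) * ∫⁻ y in ⋃ b ∈ u, closedBall b (r b), φ y ∂ν := by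
        rw [lintegral_biUnion (s := fun b => closedBall b (r b)) hu
          (fun _ _ => measurableSet_closedBall) hdisj]
    _ ≤ _ := by
        gcongr

/-! ### Measure-preserving actions -/

/-- A measure-preserving action of `ℝᵈ` on a probability space, in the sense of complete measure
spaces: the maps `T x` and the action map `(x, ω) ↦ T x ω` are only required to agree almost
everywhere with measurable maps. -/
structure IsMeasurePreservingAction {d : ℕ} {Ω : Type*} [MeasurableSpace Ω] (μ : Measure Ω)
    (T : Rd d → Ω → Ω) : Prop where
  map_zero : ∀ ω, T 0 ω = ω
  map_add : ∀ x y ω, T (x + y) ω = T x (T y ω)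
  aemeasurable : ∀ x, AEMeasurable (T x) μ
  map_eq : ∀ x, Measure.map (T x) μ = μ
  aemeasurable_prod : AEMeasurable (fun p : Rd d × Ω => T p.1 p.2) (volume.prod μ)

namespace IsMeasurePreservingAction

variable {d : ℕ} {Ω : Type*} [MeasurableSpace Ω] {μ : Measure Ω} {T : Rd d → Ω → Ω}

theorem lintegral_comp (h : IsMeasurePreservingAction μ T) {f : Ω → ENNReal}
    (hf : AEMeasurable f μ) (x : Rd d) : ∫⁻ ω, f (T x ω) ∂μ = ∫⁻ ω, f ω ∂μ := by
  rw [← lintegral_map' (by rwa [h.map_eq]) (h.aemeasurable x), h.map_eq]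

theorem ae_comp (h : IsMeasurePreservingAction μ T) {p : Ω → Prop} (hp : ∀ᵐ ω ∂μ, p ω)
    (x : Rd d) : ∀ᵐ ω ∂μ, p (T x ω) :=
  ae_of_ae_map (h.aemeasurable x) (by rwa [h.map_eq])

/-- The action map is nonsingular: the preimage of a null set is null. -/
theorem map_prod_absolutelyContinuous [SFinite μ] (h : IsMeasurePreservingAction μ T) :
    Measure.map (fun p : Rd d × Ω => T p.1 p.2) (volume.prod μ) ≪ μ := by
  refine Measure.AbsolutelyContinuous.mk fun s hs h0 => ?_
  have hi : AEMeasurable (s.indicator (1 : Ω → ENNReal))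
      (Measure.map (fun p : Rd d × Ω => T p.1 p.2) (volume.prod μ)) :=
    (measurable_one.indicator hs).aemeasurable
  rw [← lintegral_indicator_one hs, lintegral_map' hi h.aemeasurable_prod, lintegral_prod
    (fun p : Rd d × Ω => s.indicator 1 (T p.1 p.2)) (hi.comp_aemeasurable h.aemeasurable_prod)]
  simp [h.lintegral_comp (measurable_one.indicator hs).aemeasurable, lintegral_indicator_one hs, h0]

theorem aemeasurable_comp_prod [SFinite μ] {β : Type*} [MeasurableSpace β]
    (h : IsMeasurePreservingAction μ T) {f : Ω → β} (hf : AEMeasurable f μ) :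
    AEMeasurable (fun p : Rd d × Ω => f (T p.1 p.2)) (volume.prod μ) :=
  (hf.mono_ac h.map_prod_absolutelyContinuous).comp_aemeasurable h.aemeasurable_prod

end IsMeasurePreservingAction

/-! ### Stationarity makes the action measure preserving -/

namespace IsStationaryErgodicField

variable {d : ℕ} {Ω : Type*} [MetricSpace Ω] [CompactSpace Ω] [MeasurableSpace Ω] [BorelSpace Ω]
  {μ : Measure Ω} [IsProbabilityMeasure μ] {T : Rd d → Ω → Ω}
  {a : Rd d → Ω → Matrix (Fin d) (Fin d) ℝ}

theorem nullMeasurableSet_of_fieldSigmaAlgebra (h : IsStationaryErgodicField μ T a) {A : Set Ω}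
    (hA : MeasurableSet[fieldSigmaAlgebra a] A) : NullMeasurableSet A μ := by
  have : fieldSigmaAlgebra a ≤ (inferInstance : MeasurableSpace (NullMeasurableSpace Ω μ)) :=
    iSup_le fun x => by
      rintro _ ⟨s, hs, rfl⟩
      exact h.measurable_field x hs
  exact this A hA

theorem measurableSet_preimage (h : IsStationaryErgodicField μ T a) (x : Rd d) {A : Set Ω}
    (hA : MeasurableSet[fieldSigmaAlgebra a] A) : MeasurableSet[fieldSigmaAlgebra a] (T x ⁻¹' A) := by
  have : fieldSigmaAlgebra a ≤ (fieldSigmaAlgebra a).map (T x) := iSup_le fun y => by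
    rintro _ ⟨s, hs, rfl⟩
    have : T x ⁻¹' (a y ⁻¹' s) = a (x + y) ⁻¹' s := by
      ext ω
      simp [h.compatible]
    change MeasurableSet[fieldSigmaAlgebra a] (T x ⁻¹' (a y ⁻¹' s))
    rw [this]
    exact le_iSup (fun z => MeasurableSpace.comap (a z) inferInstance) (x + y) _ ⟨s, hs, rfl⟩
  exact this A hA

/-- The `σ`-algebra of the field is generated by the `π`-system of finite-dimensional events, on
which stationarity is the invariance of `μ`. -/
theorem measure_preimage_of_fieldSigmaAlgebra (h : IsStationaryErgodicField μ T a) (x : Rd d)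
    {A : Set Ω} (hA : MeasurableSet[fieldSigmaAlgebra a] A) : μ (T x ⁻¹' A) = μ A := by
  let m : Rd d → MeasurableSpace Ω := fun y => MeasurableSpace.comap (a y) inferInstance
  have hgen : fieldSigmaAlgebra a = MeasurableSpace.generateFrom
      (piiUnionInter (fun y => {s | MeasurableSet[m y] s}) Set.univ) := by
    refine Eq.trans ?_ (generateFrom_piiUnionInter_measurableSet m Set.univ).symm
    simp [fieldSigmaAlgebra, m]
  have hpi : IsPiSystem (piiUnionInter (fun y => {s | MeasurableSet[m y] s}) Set.univ) :=
    isPiSystem_piiUnionInter _ (fun y => @MeasurableSpace.isPiSystem_measurableSet Ω (m y)) _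
  refine MeasurableSpace.induction_on_inter (m := fieldSigmaAlgebra a)
    (C := fun s _ => μ (T x ⁻¹' s) = μ s) hgen hpi (by simp) ?_ ?_ ?_ A hA
  · rintro _ ⟨t, -, f, hf, rfl⟩
    have hf' : ∀ y, ∃ s : Set (Matrix (Fin d) (Fin d) ℝ), MeasurableSet s ∧
        (y ∈ t → a y ⁻¹' s = f y) := fun y => by
      by_cases hy : y ∈ t
      · obtain ⟨s, hs, e⟩ := hf y hy
        exact ⟨s, hs, fun _ => e⟩
      · exact ⟨∅, MeasurableSet.empty, fun h => absurd h hy⟩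
    choose s hs e using hf'
    have hcyl : ⋂ y ∈ t, f y = {ω | (fun i => a (t.equivFin.symm i) ω) ∈
        {v : Fin t.card → Matrix (Fin d) (Fin d) ℝ | ∀ i, v i ∈ s (t.equivFin.symm i)}} := by
      ext ω
      simp only [Set.mem_iInter, Set.mem_ofPred_eq]
      constructor
      · intro H i
        have := H _ (t.equivFin.symm i).2
        rwa [← e _ (t.equivFin.symm i).2] at this
      · intro H y hy
        have := H (t.equivFin ⟨y, hy⟩)
        rw [← e y hy]
        simpa using this
    rw [hcyl]
    refine h.stationary x t.card _ ?_ fun i => t.equivFin.symm i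
    rw [Set.ofPred_forall]
    exact MeasurableSet.iInter fun i => measurable_pi_apply i (hs _)
  · intro t ht hC
    rw [Set.preimage_compl, prob_compl_eq_one_sub₀ (h.nullMeasurableSet_of_fieldSigmaAlgebra ht),
      prob_compl_eq_one_sub₀
        (h.nullMeasurableSet_of_fieldSigmaAlgebra (h.measurableSet_preimage x ht)), hC]
  · intro f hd hm hC
    rw [Set.preimage_iUnion,
      measure_iUnion₀ (fun i j hij => (hd hij).aedisjoint)
        (fun i => h.nullMeasurableSet_of_fieldSigmaAlgebra (hm i)),
      measure_iUnion₀ (fun i j hij => ((hd hij).preimage _).aedisjoint)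
        (fun i => h.nullMeasurableSet_of_fieldSigmaAlgebra (h.measurableSet_preimage x (hm i)))]
    exact tsum_congr hC

theorem nullMeasurableSet_preimage_and_measure_eq (h : IsStationaryErgodicField μ T a) (x : Rd d)
    {A : Set Ω} (hA : NullMeasurableSet A μ) :
    NullMeasurableSet (T x ⁻¹' A) μ ∧ μ (T x ⁻¹' A) = μ A := by
  obtain ⟨L, U, hL, hU, hLA, hAU, h0⟩ := h.canonical A hA
  have hUL : MeasurableSet[fieldSigmaAlgebra a] (U \ L) := hU.diff hL
  have ae1 : L =ᵐ[μ] A := by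
    refine (LE.le.eventuallyLE hLA).antisymm ?_
    rw [ae_le_set]
    exact measure_mono_null (Set.sdiff_subset_sdiff_left hAU) h0
  have ae2 : T x ⁻¹' L =ᵐ[μ] T x ⁻¹' A := by
    refine (LE.le.eventuallyLE (Set.preimage_mono hLA)).antisymm ?_
    rw [ae_le_set]
    refine measure_mono_null (Set.sdiff_subset_sdiff_left (Set.preimage_mono hAU)) ?_
    rw [← Set.preimage_sdiff, h.measure_preimage_of_fieldSigmaAlgebra x hUL, h0]
  refine ⟨(h.nullMeasurableSet_of_fieldSigmaAlgebra (h.measurableSet_preimage x hL)).congr ae2, ?_⟩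
  rw [← measure_congr ae1, ← measure_congr ae2, h.measure_preimage_of_fieldSigmaAlgebra x hL]

theorem isMeasurePreservingAction (h : IsStationaryErgodicField μ T a) :
    IsMeasurePreservingAction μ T := by
  have hm : ∀ x, AEMeasurable (T x) μ := fun x => NullMeasurable.aemeasurable fun A hA =>
    (h.nullMeasurableSet_preimage_and_measure_eq x hA.nullMeasurableSet).1
  refine ⟨h.map_zero, h.map_add, hm, fun x => ?_, h.measurable_action.aemeasurable⟩
  ext A hA
  rw [Measure.map_apply_of_aemeasurable (hm x) hA,
    (h.nullMeasurableSet_preimage_and_measure_eq x hA.nullMeasurableSet).2]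

/-- Ergodicity in terms of preimages. -/
theorem measure_eq_zero_or_one_of_preimage_ae_eq (h : IsStationaryErgodicField μ T a) {A : Set Ω}
    (hA : NullMeasurableSet A μ) (hinv : ∀ x, T x ⁻¹' A =ᵐ[μ] A) : μ A = 0 ∨ μ A = 1 := by
  refine h.ergodic A hA fun x => ?_
  have : T x '' A = T (-x) ⁻¹' A := by
    refine congrFun (Set.image_eq_preimage_of_inverse (fun ω => ?_) (fun ω => ?_)) A
    · rw [← h.map_add, neg_add_cancel, h.map_zero]
    · rw [← h.map_add, add_neg_cancel, h.map_zero]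
  rw [this, measure_symmDiff_eq_zero_iff]
  exact hinv (-x)

end IsStationaryErgodicField

/-! ### The maximal inequality -/

namespace IsMeasurePreservingAction

open Metric

variable {d : ℕ} {Ω : Type*} [MeasurableSpace Ω] {μ : Measure Ω} {T : Rd d → Ω → Ω}

theorem aemeasurable_comp_prod_restrict [SFinite μ] (h : IsMeasurePreservingAction μ T)
    {β : Type*} [MeasurableSpace β] {f : Ω → β} (hf : AEMeasurable f μ) (B : Set (Rd d)) :
    AEMeasurable (fun p : Rd d × Ω => f (T p.1 p.2)) ((volume.restrict B).prod μ) :=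
  (h.aemeasurable_comp_prod hf).mono_ac
    (Measure.absolutelyContinuous_of_le Measure.restrict_le_self |>.prod
      Measure.AbsolutelyContinuous.rfl)

theorem lintegral_setLIntegral_comp [SFinite μ] (h : IsMeasurePreservingAction μ T)
    {f : Ω → ENNReal} (hf : AEMeasurable f μ) (B : Set (Rd d)) :
    ∫⁻ ω, (∫⁻ x in B, f (T x ω)) ∂μ = volume B * ∫⁻ ω, f ω ∂μ := by
  have hp := h.aemeasurable_comp_prod_restrict hf B
  rw [← lintegral_prod_symm (fun p : Rd d × Ω => f (T p.1 p.2)) hp,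
    lintegral_prod (fun p : Rd d × Ω => f (T p.1 p.2)) hp]
  simp [h.lintegral_comp hf, mul_comm]

/-- The points at which some ball average of `f` along the orbit, over a ball of integer radius
in `[1, N]`, is at least `c`. -/
def maximalSet (T : Rd d → Ω → Ω) (f : Ω → ENNReal) (c : ENNReal) (N : ℕ) : Set Ω :=
  {ω | ∃ n : ℕ, 0 < n ∧ n ≤ N ∧
    c * volume (closedBall (0 : Rd d) n) ≤ ∫⁻ x in closedBall (0 : Rd d) n, f (T x ω)}

theorem nullMeasurableSet_maximalSet [SFinite μ] (h : IsMeasurePreservingAction μ T)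
    {f : Ω → ENNReal} (hf : AEMeasurable f μ) (c : ENNReal) (N : ℕ) :
    NullMeasurableSet (maximalSet T f c N) μ := by
  have : maximalSet T f c N = ⋃ n : ℕ, ⋃ _ : 0 < n ∧ n ≤ N,
      {ω | c * volume (closedBall (0 : Rd d) n) ≤
        ∫⁻ x in closedBall (0 : Rd d) n, f (T x ω)} := by
    ext ω
    simp [maximalSet, and_assoc]
  rw [this]
  refine NullMeasurableSet.iUnion fun n => NullMeasurableSet.iUnion fun _ => ?_
  exact nullMeasurableSet_le aemeasurable_const
    (h.aemeasurable_comp_prod_restrict hf (closedBall (0 : Rd d) n)).lintegral_prod_left'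

/-- The covering estimate along one orbit: `T x ω` lies in the maximal set if and only if the
orbit function has a large average over some ball centred at `x`. -/
theorem mul_measure_orbit_mem_maximalSet_le (h : IsMeasurePreservingAction μ T)
    (f : Ω → ENNReal) (c : ENNReal) (N L : ℕ) (ω : Ω) :
    c * volume ((fun x => T x ω) ⁻¹' maximalSet T f c N ∩ closedBall (0 : Rd d) L)
      ≤ ENNReal.ofReal (5 ^ d) * ∫⁻ x in closedBall (0 : Rd d) (N + L), f (T x ω) := by
  have key := mul_measure_setOf_exists_lt_lintegral_closedBall_le (volume : Measure (Rd d))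
    (fun x => f (T x ω)) (closedBall 0 L) N c
  rw [cthickening_closedBall N.cast_nonneg L.cast_nonneg, finrank_euclideanSpace_fin] at key
  refine le_trans ?_ key
  gcongr
  rintro x ⟨⟨n, hn, hnN, hle⟩, hx⟩
  refine ⟨hx, n, by exact_mod_cast hn, by exact_mod_cast hnN, ?_⟩
  have hpre : (fun y => y + x) ⁻¹' closedBall x (n : ℝ) = closedBall (0 : Rd d) n := by
    ext y
    simp [dist_eq_norm]
  rw [Measure.addHaar_closedBall_center,
    ← (measurePreserving_add_right (volume : Measure (Rd d)) x).setLIntegral_comp_preimage_emb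
      (measurableEmbedding_addRight x), hpre]
  simpa only [h.map_add] using hle

/-- Wiener's maximal inequality for balls of bounded radius. Averaging the covering estimate over
the orbit segments `{T x ω : |x| ≤ L}` transfers it to `Ω` at the cost of a boundary factor
`((L + N) / L) ^ d`, which disappears as `L → ∞`. -/
theorem mul_measure_maximalSet_le [SFinite μ] (h : IsMeasurePreservingAction μ T)
    {f : Ω → ENNReal} (hf : AEMeasurable f μ) (c : ENNReal) (N : ℕ) :
    c * μ (maximalSet T f c N) ≤ ENNReal.ofReal (5 ^ d) * ∫⁻ ω, f ω ∂μ := by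
  have hE := h.nullMeasurableSet_maximalSet hf c N
  have hind : AEMeasurable ((maximalSet T f c N).indicator (1 : Ω → ENNReal)) μ :=
    aemeasurable_one.indicator₀ hE
  have hL : ∀ L : ℕ, volume (closedBall (0 : Rd d) L) * (c * μ (maximalSet T f c N)) ≤
      volume (closedBall (0 : Rd d) (N + L)) * (ENNReal.ofReal (5 ^ d) * ∫⁻ ω, f ω ∂μ) := by
    intro L
    -- Every `T x` preserves `μ`, so the left side measures the visits of the orbit segments to the
    -- maximal set, integrated over their starting points.
    calc volume (closedBall (0 : Rd d) L) * (c * μ (maximalSet T f c N))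
        = c * ∫⁻ ω, (∫⁻ x in closedBall (0 : Rd d) L,
            (maximalSet T f c N).indicator 1 (T x ω)) ∂μ := by
          rw [h.lintegral_setLIntegral_comp hind, lintegral_indicator_one₀ hE, mul_left_comm]
      _ = ∫⁻ ω, (c * ∫⁻ x in closedBall (0 : Rd d) L,
            (maximalSet T f c N).indicator 1 (T x ω)) ∂μ :=
          (lintegral_const_mul'' c (h.aemeasurable_comp_prod_restrict hind _).lintegral_prod_left').symm
      _ ≤ ∫⁻ ω, (ENNReal.ofReal (5 ^ d) *
            ∫⁻ x in closedBall (0 : Rd d) (N + L), f (T x ω)) ∂μ := by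
          refine lintegral_mono fun ω => le_trans ?_ (h.mul_measure_orbit_mem_maximalSet_le f c N L ω)
          gcongr
          rw [← Measure.restrict_apply' measurableSet_closedBall]
          exact lintegral_indicator_one_le ((fun x => T x ω) ⁻¹' maximalSet T f c N)
      _ = _ := by
          rw [lintegral_const_mul'' _ (h.aemeasurable_comp_prod_restrict hf _).lintegral_prod_left',
            h.lintegral_setLIntegral_comp hf, mul_left_comm]
  have hlim : Tendsto (fun L : ℕ => ENNReal.ofReal ((1 + (N : ℝ) / L) ^ d) *
      (ENNReal.ofReal (5 ^ d) * ∫⁻ ω, f ω ∂μ)) atTop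
      (𝓝 (1 * (ENNReal.ofReal (5 ^ d) * ∫⁻ ω, f ω ∂μ))) := by
    refine ENNReal.Tendsto.mul_const ?_ (Or.inl one_ne_zero)
    have : Tendsto (fun L : ℕ => (1 + (N : ℝ) / L) ^ d) atTop (𝓝 1) := by
      simpa using ((tendsto_const_div_atTop_nhds_zero_nat (N : ℝ)).const_add 1).pow d
    simpa using ENNReal.tendsto_ofReal this
  rw [one_mul] at hlim
  refine ge_of_tendsto hlim ?_
  filter_upwards [eventually_gt_atTop 0] with L hL0
  have hL0' : (0 : ℝ) < L := by exact_mod_cast hL0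
  have hvol : volume (closedBall (0 : Rd d) (N + L)) =
      ENNReal.ofReal ((1 + (N : ℝ) / L) ^ d) * volume (closedBall (0 : Rd d) L) := by
    have := Measure.addHaar_closedBall_mul (volume : Measure (Rd d)) (0 : Rd d)
      (r := 1 + (N : ℝ) / L) (by positivity) hL0'.le
    rwa [finrank_euclideanSpace_fin, add_mul, one_mul, div_mul_cancel₀ _ hL0'.ne', add_comm] at this
  have h1 := hL L
  rw [hvol, mul_comm (ENNReal.ofReal _) (volume _), mul_assoc] at h1
  exact (ENNReal.mul_le_mul_iff_right (measure_closedBall_pos volume _ hL0').ne'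
    measure_closedBall_lt_top.ne).1 h1

/-- Wiener's maximal inequality. -/
theorem mul_measure_iUnion_maximalSet_le [SFinite μ] (h : IsMeasurePreservingAction μ T)
    {f : Ω → ENNReal} (hf : AEMeasurable f μ) (c : ENNReal) :
    c * μ (⋃ N, maximalSet T f c N) ≤ ENNReal.ofReal (5 ^ d) * ∫⁻ ω, f ω ∂μ := by
  have hmono : Monotone (maximalSet T f c) := fun M N hMN ω ⟨n, h0, hn, hle⟩ =>
    ⟨n, h0, hn.trans hMN, hle⟩
  rw [hmono.measure_iUnion, ENNReal.mul_iSup]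
  exact iSup_le fun N => h.mul_measure_maximalSet_le hf c N

end IsMeasurePreservingAction

/-! ### The mean ergodic theorem -/

namespace IsMeasurePreservingAction

variable {d : ℕ} {Ω : Type*} [MeasurableSpace Ω] {μ : Measure Ω} {T : Rd d → Ω → Ω}

theorem memLp_comp (h : IsMeasurePreservingAction μ T) {g : Ω → ℝ} {p : ENNReal}
    (hg : MemLp g p μ) (x : Rd d) : MemLp (fun ω => g (T x ω)) p μ :=
  (show MemLp g p (Measure.map (T x) μ) by rwa [h.map_eq]).comp_of_map (h.aemeasurable x)

theorem integral_comp (h : IsMeasurePreservingAction μ T) {g : Ω → ℝ}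
    (hg : AEStronglyMeasurable g μ) (x : Rd d) : ∫ ω, g (T x ω) ∂μ = ∫ ω, g ω ∂μ := by
  rw [← MeasureTheory.integral_map (h.aemeasurable x) (by rwa [h.map_eq]), h.map_eq]

/-- Translation acts isometrically on `L²`. The map `T x` itself need not be measurable, so the
isometry is composition with a measurable modification of it. -/
theorem exists_linearIsometry (h : IsMeasurePreservingAction μ T) (x : Rd d) :
    ∃ U : Lp ℝ 2 μ →ₗᵢ[ℝ] Lp ℝ 2 μ, ∀ v : Lp ℝ 2 μ, U v =ᵐ[μ] fun ω => v (T x ω) := by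
  have hae := (h.aemeasurable x).ae_eq_mk
  have hS : MeasurePreserving ((h.aemeasurable x).mk (T x)) μ μ :=
    ⟨(h.aemeasurable x).measurable_mk, by rw [← Measure.map_congr hae, h.map_eq]⟩
  refine ⟨Lp.compMeasurePreservingₗᵢ ℝ _ hS, fun v => ?_⟩
  filter_upwards [Lp.coeFn_compMeasurePreserving v hS, hae] with ω h1 h2
  rw [h2]
  exact h1

theorem exists_ae_eq_const_of_invariant [IsProbabilityMeasure μ]
    (herg : ∀ A : Set Ω, NullMeasurableSet A μ → (∀ x, T x ⁻¹' A =ᵐ[μ] A) → μ A = 0 ∨ μ A = 1)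
    {f : Ω → ℝ} (hf : AEMeasurable f μ) (hinv : ∀ x, (fun ω => f (T x ω)) =ᵐ[μ] f) :
    ∃ c : ℝ, f =ᵐ[μ] fun _ => c := by
  refine exists_eventuallyEq_const_of_eventually_mem_of_forall_separating MeasurableSet
    (s := Set.univ) (by simp) fun U hU => ?_
  have hA := hf.nullMeasurableSet_preimage hU
  have hAinv : ∀ x, T x ⁻¹' (f ⁻¹' U) =ᵐ[μ] (f ⁻¹' U : Set Ω) := fun x => by
    filter_upwards [hinv x] with ω hω
    exact congrArg U hω
  rcases herg _ hA hAinv with h0 | h1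
  · exact Or.inr (measure_eq_zero_iff_ae_notMem.1 h0)
  · exact Or.inl ((mem_ae_iff_prob_eq_one₀ hA).2 h1)

/-- A version of the mean ergodic theorem that needs no averaging sets: the expectation of `g` is
a limit in `L¹` of convex combinations of translates of `g`. The element of least norm of the
closed convex hull of the translates in `L²` is unique, hence invariant, hence constant. -/
theorem exists_mem_convexHull_lintegral_sub_le [IsProbabilityMeasure μ]
    (h : IsMeasurePreservingAction μ T)
    (herg : ∀ A : Set Ω, NullMeasurableSet A μ → (∀ x, T x ⁻¹' A =ᵐ[μ] A) → μ A = 0 ∨ μ A = 1)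
    {g : Ω → ℝ} (hg : MemLp g 2 μ) {ε : ENNReal} (hε : ε ≠ 0) :
    ∃ f ∈ convexHull ℝ (Set.range fun (y : Rd d) (ω : Ω) => g (T y ω)),
      AEMeasurable f μ ∧ ∫⁻ ω, ‖f ω - ∫ ω', g ω' ∂μ‖ₑ ∂μ ≤ ε := by
  let G : Rd d → Lp ℝ 2 μ := fun y => (h.memLp_comp hg y).toLp _
  have hG : ∀ y, G y =ᵐ[μ] fun ω => g (T y ω) := fun y => (h.memLp_comp hg y).coeFn_toLp
  let K : Set (Lp ℝ 2 μ) := closure (convexHull ℝ (Set.range G))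
  have hKconv : Convex ℝ K := (convex_convexHull ℝ _).closure
  have hKne : K.Nonempty := ⟨G 0, subset_closure (subset_convexHull ℝ _ ⟨0, rfl⟩)⟩
  obtain ⟨v, hvK, hv⟩ := exists_norm_eq_iInf_of_complete_convex hKne
    isClosed_closure.isComplete hKconv 0
  have hvin := (norm_eq_iInf_iff_real_inner_le_zero hKconv hvK).1 hv
  -- The minimizer is unique and the translations preserve both `K` and the norm.
  have huniq : ∀ w ∈ K, ‖w‖ = ‖v‖ → w = v := fun w hw hwv => by
    have h1 := hvin w hw
    rw [zero_sub, inner_neg_left, inner_sub_right, real_inner_self_eq_norm_sq] at h1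
    have h2 := norm_sub_sq_real w v
    rw [real_inner_comm, hwv] at h2
    have h3 : ‖w - v‖ ^ 2 ≤ 0 := by linarith
    exact sub_eq_zero.1 (norm_eq_zero.1 (pow_eq_zero_iff two_ne_zero |>.1
      (le_antisymm h3 (sq_nonneg _))))
  have hvinv : ∀ x, (fun ω => v (T x ω)) =ᵐ[μ] v := fun x => by
    obtain ⟨U, hU⟩ := h.exists_linearIsometry x
    have hUG : ∀ y, U (G y) = G (y + x) := fun y => by
      refine Lp.ext ?_
      filter_upwards [hU (G y), h.ae_comp (hG y) x, hG (y + x)] with ω h1 h2 h3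
      rw [h1, h2, h3, h.map_add]
    have hUK : U v ∈ K := by
      refine map_mem_closure U.continuous hvK fun w hw => ?_
      have : U w ∈ U.toLinearMap '' convexHull ℝ (Set.range G) := ⟨w, hw, rfl⟩
      rw [U.toLinearMap.image_convexHull] at this
      refine convexHull_mono ?_ this
      rintro _ ⟨_, ⟨y, rfl⟩, rfl⟩
      exact ⟨y + x, (hUG y).symm⟩
    have := hU v
    rw [huniq _ hUK (U.norm_map v)] at this
    exact this.symm
  obtain ⟨c, hc⟩ := exists_ae_eq_const_of_invariant herg (Lp.aestronglyMeasurable v).aemeasurable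
    hvinv
  -- The integral is a continuous linear functional, constant on the orbit and so on `K`.
  have hint : ∀ w ∈ K, ∫ ω, w ω ∂μ = ∫ ω, g ω ∂μ := by
    let one : Lp ℝ 2 μ := indicatorConstLp 2 MeasurableSet.univ (measure_ne_top μ _) 1
    have hone : ∀ w : Lp ℝ 2 μ, ∫ ω, w ω ∂μ = inner ℝ one w := fun w => by
      rw [L2.inner_indicatorConstLp_one, setIntegral_univ]
    have hclosed : IsClosed {w : Lp ℝ 2 μ | inner ℝ one w = ∫ ω, g ω ∂μ} :=
      isClosed_eq (by fun_prop) continuous_const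
    have hconv : Convex ℝ {w : Lp ℝ 2 μ | inner ℝ one w = ∫ ω, g ω ∂μ} :=
      convex_hyperplane (innerₛₗ ℝ one).isLinear _
    intro w hw
    rw [hone]
    refine closure_minimal (convexHull_min ?_ hconv) hclosed hw
    rintro _ ⟨y, rfl⟩
    rw [Set.mem_ofPred_eq, ← hone, integral_congr_ae (hG y), h.integral_comp hg.1]
  have hcg : c = ∫ ω, g ω ∂μ := by
    rw [← hint v hvK, integral_congr_ae hc]
    simp
  -- A convex combination close to `v` in `L²` is represented by one of genuine functions.
  obtain ⟨w, hw, hwv⟩ := EMetric.mem_closure_iff.1 hvK ε (pos_iff_ne_zero.2 hε)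
  have hrep : convexHull ℝ (Set.range G) ⊆ {w | ∃ f ∈ convexHull ℝ
      (Set.range fun (y : Rd d) (ω : Ω) => g (T y ω)), w =ᵐ[μ] f} := by
    refine convexHull_min ?_ ?_
    · rintro _ ⟨y, rfl⟩
      exact ⟨_, subset_convexHull ℝ _ ⟨y, rfl⟩, hG y⟩
    · rintro w₁ ⟨f₁, hf₁, e₁⟩ w₂ ⟨f₂, hf₂, e₂⟩ s t hs ht hst
      refine ⟨s • f₁ + t • f₂, convex_convexHull ℝ _ hf₁ hf₂ hs ht hst, ?_⟩
      filter_upwards [e₁, e₂, Lp.coeFn_add (s • w₁) (t • w₂), Lp.coeFn_smul s w₁,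
        Lp.coeFn_smul t w₂] with ω h1 h2 h3 h4 h5
      rw [h3, Pi.add_apply, h4, h5]
      simp [h1, h2]
  obtain ⟨f, hf, hwf⟩ := hrep hw
  refine ⟨f, hf, (Lp.aestronglyMeasurable w).aemeasurable.congr hwf, ?_⟩
  calc ∫⁻ ω, ‖f ω - ∫ ω', g ω' ∂μ‖ₑ ∂μ = eLpNorm (⇑v - ⇑w) 1 μ := by
        rw [eLpNorm_one_eq_lintegral_enorm]
        refine lintegral_congr_ae ?_
        filter_upwards [hwf, hc] with ω h1 h2
        rw [Pi.sub_apply, h1, h2, hcg, ← enorm_neg, neg_sub]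
    _ ≤ eLpNorm (⇑v - ⇑w) 2 μ := eLpNorm_le_eLpNorm_of_exponent_le (by norm_num)
        ((Lp.aestronglyMeasurable v).sub (Lp.aestronglyMeasurable w))
    _ ≤ ε := by
        rw [← Lp.edist_def]
        exact hwv.le

end IsMeasurePreservingAction

/-! ### Averages over dilated sets -/

section DilatedSets

open Metric

variable {d : ℕ}

theorem measureReal_smul_set (A : Set (Rd d)) {t : ℝ} (ht : 0 ≤ t) :
    volume.real (t • A) = t ^ d * volume.real A := by
  rw [measureReal_def, Measure.addHaar_smul, finrank_euclideanSpace_fin, abs_of_nonneg (by positivity),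
    ENNReal.toReal_mul, ENNReal.toReal_ofReal (by positivity), measureReal_def]

theorem measure_smul_set_lt_top {A : Set (Rd d)} (hA : Bornology.IsBounded A) (t : ℝ) :
    volume (t • A) < ⊤ :=
  (hA.smul₀ t).measure_lt_top

theorem integrableOn_smul_set {A : Set (Rd d)} (hA : Bornology.IsBounded A) {φ : Rd d → ℝ}
    (hφ : AEStronglyMeasurable φ volume) {M : ℝ} (hM : ∀ x, ‖φ x‖ ≤ M) (t : ℝ) :
    IntegrableOn φ (t • A) :=
  Measure.integrableOn_of_bounded (measure_smul_set_lt_top hA t).ne hφ (ae_of_all _ hM)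

theorem norm_average_smul_set_le {A : Set (Rd d)} (hA : Bornology.IsBounded A)
    (hA0 : 0 < volume A) {φ : Rd d → ℝ} {M : ℝ} (hM : ∀ x, ‖φ x‖ ≤ M) {t : ℝ} (ht : 0 < t) :
    ‖(t ^ d * volume.real A)⁻¹ * ∫ x in t • A, φ x‖ ≤ M := by
  have hpos : 0 < t ^ d * volume.real A :=
    mul_pos (pow_pos ht d) (ENNReal.toReal_pos hA0.ne' hA.measure_lt_top.ne)
  have := norm_setIntegral_le_of_norm_le_const (measure_smul_set_lt_top hA t) fun x _ => hM x
  rw [measureReal_smul_set A ht.le] at this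
  rw [norm_mul, norm_inv, Real.norm_of_nonneg hpos.le, inv_mul_le_iff₀ hpos, mul_comm]
  exact this

/-- Translating a dilated set `t • A` by a fixed vector changes a proportion of its volume that
vanishes as `t → ∞`. -/
theorem tendsto_measureReal_symmDiff_translate {A : Set (Rd d)} (hA : MeasurableSet A)
    (hA' : Bornology.IsBounded A) (y : Rd d) :
    Tendsto (fun t : ℝ => (t ^ d)⁻¹ * volume.real (((y + ·) ⁻¹' (t • A)) ∆ (t • A)))
      atTop (𝓝 0) := by
  let F : C(Rd d, C(Rd d, Rd d)) := ContinuousMap.curry ⟨fun p => p.1 + p.2, continuous_add⟩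
  have h0 : Tendsto (fun t : ℝ => t⁻¹ • y) atTop (𝓝 0) := by
    simpa using (tendsto_inv_atTop_zero (𝕜 := ℝ)).smul_const y
  have key := tendsto_measure_symmDiff_preimage_nhds_zero (μ := (volume : Measure (Rd d)))
    (ν := (volume : Measure (Rd d))) ((F.continuous.tendsto 0).comp h0)
    (Eventually.of_forall fun t => measurePreserving_add_left volume (t⁻¹ • y))
    (measurePreserving_add_left volume 0) hA.nullMeasurableSet hA'.measure_lt_top.ne
  have key' := (ENNReal.tendsto_toReal ENNReal.zero_ne_top).comp key
  refine Tendsto.congr' ?_ key'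
  filter_upwards [eventually_gt_atTop 0] with t ht
  have hset : ((y + ·) ⁻¹' (t • A)) ∆ (t • A) =
      t • (((t⁻¹ • y + ·) ⁻¹' A) ∆ (((0 : Rd d) + ·) ⁻¹' A)) := by
    rw [Set.smul_set_symmDiff₀ ht.ne']
    congr 1
    · ext x
      simp [Set.mem_smul_set_iff_inv_smul_mem₀ ht.ne', smul_add]
    · simp
  rw [hset, measureReal_smul_set _ ht.le, inv_mul_cancel_left₀ (pow_pos ht d).ne']
  rfl

theorem norm_setIntegral_sub_setIntegral_le {B B' : Set (Rd d)} (hB : MeasurableSet B)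
    (hB' : MeasurableSet B') (hfB : volume B ≠ ⊤) (hfB' : volume B' ≠ ⊤) {φ : Rd d → ℝ}
    (hφ : AEStronglyMeasurable φ volume) {M : ℝ} (hM : ∀ x, ‖φ x‖ ≤ M) :
    ‖(∫ x in B, φ x) - ∫ x in B', φ x‖ ≤ M * volume.real (B ∆ B') := by
  have hi : IntegrableOn φ B := Measure.integrableOn_of_bounded hfB hφ (ae_of_all _ hM)
  have hi' : IntegrableOn φ B' := Measure.integrableOn_of_bounded hfB' hφ (ae_of_all _ hM)
  have hsd : MeasurableSet (B ∆ B') := hB.symmDiff hB'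
  rw [← integral_indicator hB, ← integral_indicator hB',
    ← integral_sub (hi.integrable_indicator hB) (hi'.integrable_indicator hB')]
  have hb : ∫ x, (B ∆ B').indicator (fun _ => M) x = M * volume.real (B ∆ B') := by
    rw [integral_indicator_const _ hsd, smul_eq_mul, mul_comm]
  rw [← hb]
  refine norm_integral_le_of_norm_le ?_ (ae_of_all _ fun x => ?_)
  · refine (integrable_indicator_iff hsd).2 (integrableOn_const ?_)
    exact ((measure_mono Set.symmDiff_subset_union).trans_lt
      ((measure_union_lt_top hfB.lt_top hfB'.lt_top))).ne
  · have := hM x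
    by_cases h1 : x ∈ B <;> by_cases h2 : x ∈ B' <;> simp [h1, h2, Set.mem_symmDiff] <;>
      simpa using this

/-- Replacing an orbit function by a convex combination of its translates does not change its
asymptotic averages over dilated sets. -/
theorem tendsto_setIntegral_sub_of_mem_convexHull {ψ : Rd d → ℝ}
    (hψ : AEStronglyMeasurable ψ volume) {M : ℝ} (hM : ∀ x, ‖ψ x‖ ≤ M) {η : Rd d → ℝ}
    (hη : η ∈ convexHull ℝ (Set.range fun (y : Rd d) (x : Rd d) => ψ (x + y))) {A : Set (Rd d)}
    (hA : MeasurableSet A) (hA' : Bornology.IsBounded A) :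
    AEStronglyMeasurable η volume ∧ (∀ x, ‖η x‖ ≤ M) ∧
      Tendsto (fun t : ℝ => (t ^ d)⁻¹ * ((∫ x in t • A, η x) - ∫ x in t • A, ψ x))
        atTop (𝓝 0) := by
  refine convexHull_min (t := {η | AEStronglyMeasurable η volume ∧ (∀ x, ‖η x‖ ≤ M) ∧
    Tendsto (fun t : ℝ => (t ^ d)⁻¹ * ((∫ x in t • A, η x) - ∫ x in t • A, ψ x))
      atTop (𝓝 0)}) ?_ ?_ hη
  · rintro _ ⟨y, rfl⟩
    refine ⟨hψ.comp_measurePreserving (measurePreserving_add_right volume y), fun x => hM _, ?_⟩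
    refine squeeze_zero_norm' ?_
      (by simpa using (tendsto_measureReal_symmDiff_translate hA hA' (-y)).const_mul M)
    filter_upwards [eventually_gt_atTop 0] with t ht
    have hpre : (· + y) ⁻¹' ((-y + ·) ⁻¹' (t • A)) = t • A := by
      ext x
      simp
    have htr : ∫ x in t • A, ψ (x + y) = ∫ x in (-y + ·) ⁻¹' (t • A), ψ x := by
      rw [← (measurePreserving_add_right (volume : Measure (Rd d)) y).setIntegral_preimage_emb
        (measurableEmbedding_addRight y) ψ, hpre]
    have htA : MeasurableSet (t • A) := hA.const_smul₀ t
    have hfin := (measure_smul_set_lt_top hA' t).ne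
    have hle := norm_setIntegral_sub_setIntegral_le (htA.preimage (measurable_const_add (-y))) htA
      (by rwa [measure_preimage_add]) hfin hψ hM
    rw [htr, norm_mul, norm_inv, Real.norm_of_nonneg (pow_pos ht d).le, mul_left_comm]
    gcongr
  · rintro η₁ ⟨hm₁, hb₁, ht₁⟩ η₂ ⟨hm₂, hb₂, ht₂⟩ a b ha hb hab
    refine ⟨(hm₁.const_smul a).add (hm₂.const_smul b), fun x => ?_, ?_⟩
    · exact mem_closedBall_zero_iff.1 ((convex_closedBall (0 : ℝ) M)
        (mem_closedBall_zero_iff.2 (hb₁ x)) (mem_closedBall_zero_iff.2 (hb₂ x)) ha hb hab)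
    · have := (ht₁.const_mul a).add (ht₂.const_mul b)
      rw [mul_zero, mul_zero, add_zero] at this
      refine this.congr fun t => ?_
      have hadd : ∫ x in t • A, (a • η₁ + b • η₂) x =
          a * (∫ x in t • A, η₁ x) + b * ∫ x in t • A, η₂ x := by
        rw [← integral_const_mul, ← integral_const_mul]
        exact integral_add ((integrableOn_smul_set hA' hm₁ hb₁ t).const_mul a)
          ((integrableOn_smul_set hA' hm₂ hb₂ t).const_mul b)
      rw [hadd]
      linear_combination (-(t ^ d)⁻¹ * ∫ x in t • A, ψ x) * hab

/-- The hypothesis provides, for every `ε`, a convex combination of translates of `ψ` whose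
maximal ball average of the distance to `c` is at most `ε`. It does not involve `A`, so that a
single exceptional set serves for all `A`. -/
theorem tendsto_average_smul_set {ψ : Rd d → ℝ}
    (hψ : AEStronglyMeasurable ψ volume) {M : ℝ} (hM : ∀ x, ‖ψ x‖ ≤ M) (c : ℝ)
    (hc : ∀ ε : ℝ, 0 < ε → ∃ η ∈ convexHull ℝ (Set.range fun (y : Rd d) (x : Rd d) => ψ (x + y)),
      ∀ n : ℕ, 0 < n → ∫⁻ x in closedBall (0 : Rd d) n, ‖η x - c‖ₑ ≤
        ENNReal.ofReal ε * volume (closedBall (0 : Rd d) n))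
    {A : Set (Rd d)} (hA : MeasurableSet A) (hA' : Bornology.IsBounded A) (hA0 : 0 < volume A) :
    Tendsto (fun t : ℝ => (t ^ d * volume.real A)⁻¹ * ∫ x in t • A, ψ x) atTop (𝓝 c) := by
  have hV : 0 < volume.real A := ENNReal.toReal_pos hA0.ne' hA'.measure_lt_top.ne
  obtain ⟨r, hr0, hr⟩ := hA'.subset_closedBall_lt 0 0
  set κ : ℝ := volume.real (closedBall (0 : Rd d) 1) with hκ
  have hκ0 : 0 < κ := ENNReal.toReal_pos (measure_closedBall_pos volume _ one_pos).ne'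
    measure_closedBall_lt_top.ne
  set C : ℝ := (r + 1) ^ d * κ / volume.real A with hC
  have hC0 : 0 < C := by positivity
  rw [Metric.tendsto_nhds]
  intro δ hδ
  obtain ⟨η, hη, hmax⟩ := hc (δ / 2 / C) (by positivity)
  obtain ⟨hηm, hηb, hlim⟩ := tendsto_setIntegral_sub_of_mem_convexHull hψ hM hη hA hA'
  have hlim' := hlim.const_mul (volume.real A)⁻¹
  rw [mul_zero, Metric.tendsto_nhds] at hlim'
  filter_upwards [hlim' (δ / 2) (by positivity), eventually_ge_atTop 1] with t h1 ht
  have ht0 : 0 < t := one_pos.trans_le ht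
  have htd : 0 < t ^ d := pow_pos ht0 d
  -- An integer radius, positive even when `r * t < 1`, whose ball contains `t • A` and has volume
  -- comparable to `t ^ d`.
  set n : ℕ := ⌊r * t⌋₊ + 1 with hn
  have hsub : t • A ⊆ closedBall (0 : Rd d) n := by
    rintro _ ⟨x, hx, rfl⟩
    have hx' := mem_closedBall_zero_iff.1 (hr hx)
    rw [mem_closedBall_zero_iff, norm_smul, Real.norm_of_nonneg ht0.le, hn]
    push_cast
    nlinarith [Nat.lt_floor_add_one (r * t)]
  have hnle : (n : ℝ) ≤ (r + 1) * t := by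
    rw [hn]
    push_cast
    nlinarith [Nat.floor_le (mul_pos hr0 ht0).le]
  have hvol : volume.real (closedBall (0 : Rd d) n) = (n : ℝ) ^ d * κ := by
    have := Measure.addHaar_closedBall_mul (volume : Measure (Rd d)) (0 : Rd d)
      (r := (n : ℝ)) n.cast_nonneg zero_le_one
    rw [mul_one, finrank_euclideanSpace_fin] at this
    rw [measureReal_def, this, ENNReal.toReal_mul, ENNReal.toReal_ofReal (by positivity), hκ,
      measureReal_def]
  have hint : IntegrableOn (fun x => η x - c) (t • A) :=
    (integrableOn_smul_set hA' hηm hηb t).sub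
      (integrableOn_const (measure_smul_set_lt_top hA' t).ne)
  have h2 : ‖∫ x in t • A, (η x - c)‖ ≤ δ / 2 / C * ((n : ℝ) ^ d * κ) := by
    rw [← hvol, measureReal_def, ← toReal_enorm, ← ENNReal.toReal_ofReal (r := δ / 2 / C)
      (by positivity), ← ENNReal.toReal_mul]
    refine ENNReal.toReal_mono
      (ENNReal.mul_ne_top ENNReal.ofReal_ne_top measure_closedBall_lt_top.ne) ?_
    exact (enorm_integral_le_lintegral_enorm _).trans
      ((lintegral_mono_set hsub).trans (hmax n (Nat.succ_pos _)))
  have h3 : ‖(t ^ d * volume.real A)⁻¹ * ∫ x in t • A, (η x - c)‖ ≤ δ / 2 := by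
    rw [norm_mul, norm_inv, Real.norm_of_nonneg (mul_pos htd hV).le,
      inv_mul_le_iff₀ (mul_pos htd hV)]
    refine h2.trans ?_
    have : (n : ℝ) ^ d ≤ (r + 1) ^ d * t ^ d := by
      rw [← mul_pow]
      gcongr
    calc δ / 2 / C * ((n : ℝ) ^ d * κ) ≤ δ / 2 / C * ((r + 1) ^ d * t ^ d * κ) := by gcongr
      _ = t ^ d * volume.real A * (δ / 2) := by
        rw [hC]
        field_simp
  have h4 : (t ^ d * volume.real A)⁻¹ * (∫ x in t • A, ψ x) - c =
      (t ^ d * volume.real A)⁻¹ * (∫ x in t • A, (η x - c)) -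
        (volume.real A)⁻¹ * ((t ^ d)⁻¹ * ((∫ x in t • A, η x) - ∫ x in t • A, ψ x)) := by
    rw [integral_sub (integrableOn_smul_set hA' hηm hηb t)
      (integrableOn_const (measure_smul_set_lt_top hA' t).ne), setIntegral_const,
      measureReal_smul_set A ht0.le, smul_eq_mul]
    field_simp
    ring
  rw [dist_zero_right] at h1
  rw [dist_eq_norm, h4]
  linarith [norm_sub_le ((t ^ d * volume.real A)⁻¹ * (∫ x in t • A, (η x - c)))
    ((volume.real A)⁻¹ * ((t ^ d)⁻¹ * ((∫ x in t • A, η x) - ∫ x in t • A, ψ x)))]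

end DilatedSets

/-! ### The pointwise ergodic theorem -/

namespace IsMeasurePreservingAction

open Metric

variable {d : ℕ} {Ω : Type*} [MeasurableSpace Ω] {μ : Measure Ω} [IsProbabilityMeasure μ]
  {T : Rd d → Ω → Ω}

/-- The mean ergodic theorem makes `f - 𝔼 g` small in `L¹` for some convex combination `f` of
translates of `g`, and the maximal inequality then makes its maximal ball average small outside a
set of small measure. -/
theorem ae_exists_mem_convexHull_maximal_le (h : IsMeasurePreservingAction μ T)
    (herg : ∀ A : Set Ω, NullMeasurableSet A μ → (∀ x, T x ⁻¹' A =ᵐ[μ] A) → μ A = 0 ∨ μ A = 1)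
    {g : Ω → ℝ} (hg : MemLp g 2 μ) {ε : ℝ} (hε : 0 < ε) :
    ∀ᵐ ω ∂μ, ∃ η ∈ convexHull ℝ (Set.range fun (y : Rd d) (x : Rd d) => g (T (x + y) ω)),
      ∀ n : ℕ, 0 < n → ∫⁻ x in closedBall (0 : Rd d) n, ‖η x - ∫ ω', g ω' ∂μ‖ₑ ≤
        ENNReal.ofReal ε * volume (closedBall (0 : Rd d) n) := by
  set c : ℝ := ∫ ω', g ω' ∂μ
  rw [ae_iff]
  set bad : Set Ω := {ω | ¬ ∃ η ∈ convexHull ℝ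
      (Set.range fun (y : Rd d) (x : Rd d) => g (T (x + y) ω)),
      ∀ n : ℕ, 0 < n → ∫⁻ x in closedBall (0 : Rd d) n, ‖η x - c‖ₑ ≤
        ENNReal.ofReal ε * volume (closedBall (0 : Rd d) n)}
  have h5 : ENNReal.ofReal (5 ^ d) ≠ 0 := (ENNReal.ofReal_pos.2 (by positivity)).ne'
  have hle : ∀ e : ENNReal, 0 < e → ENNReal.ofReal ε * μ bad ≤ e := fun e he => by
    obtain ⟨f, hf, hfm, hfe⟩ := h.exists_mem_convexHull_lintegral_sub_le herg hg
      (ENNReal.div_pos he.ne' (ENNReal.ofReal_ne_top (r := 5 ^ d))).ne'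
    have hsub : bad ⊆ ⋃ N, maximalSet T (fun ω => ‖f ω - c‖ₑ) (ENNReal.ofReal ε) N := by
      intro ω hω
      by_contra hcon
      refine hω ⟨fun x => f (T x ω), ?_, fun n hn => ?_⟩
      · have : LinearMap.funLeft ℝ ℝ (fun x => T x ω) f ∈ LinearMap.funLeft ℝ ℝ (fun x => T x ω) ''
            convexHull ℝ (Set.range fun (y : Rd d) (ω : Ω) => g (T y ω)) := ⟨f, hf, rfl⟩
        rw [LinearMap.image_convexHull] at this
        refine convexHull_mono ?_ this
        rintro _ ⟨_, ⟨y, rfl⟩, rfl⟩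
        refine ⟨y, funext fun x => ?_⟩
        change g (T (x + y) ω) = g (T y (T x ω))
        rw [add_comm, h.map_add]
      · by_contra hlt
        exact hcon (Set.mem_iUnion.2 ⟨n, n, hn, le_rfl, (not_le.1 hlt).le⟩)
    calc ENNReal.ofReal ε * μ bad ≤ ENNReal.ofReal ε *
          μ (⋃ N, maximalSet T (fun ω => ‖f ω - c‖ₑ) (ENNReal.ofReal ε) N) := by gcongr
      _ ≤ ENNReal.ofReal (5 ^ d) * ∫⁻ ω, ‖f ω - c‖ₑ ∂μ :=
        h.mul_measure_iUnion_maximalSet_le (hfm.sub_const c).enorm _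
      _ ≤ ENNReal.ofReal (5 ^ d) * (e / ENNReal.ofReal (5 ^ d)) := by gcongr
      _ = e := ENNReal.mul_div_cancel h5 ENNReal.ofReal_ne_top
  have h0 : ENNReal.ofReal ε * μ bad = 0 :=
    nonpos_iff_eq_zero.1 (le_of_forall_gt_imp_ge_of_dense hle)
  exact (mul_eq_zero.1 h0).resolve_left (ENNReal.ofReal_pos.2 hε).ne'

theorem ae_aemeasurable_orbit (h : IsMeasurePreservingAction μ T) :
    ∀ᵐ ω ∂μ, AEMeasurable (fun x => T x ω) volume := by
  have hS := h.aemeasurable_prod.measurable_mk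
  have hae : ∀ᵐ p ∂(μ.prod (volume : Measure (Rd d))),
      T p.2 p.1 = h.aemeasurable_prod.mk _ (p.2, p.1) :=
    Measure.measurePreserving_swap.quasiMeasurePreserving.ae h.aemeasurable_prod.ae_eq_mk
  filter_upwards [Measure.ae_ae_of_ae_prod hae] with ω hω
  exact ⟨_, hS.comp measurable_prodMk_right, hω⟩

/-- Wiener's pointwise ergodic theorem for a bounded function, with one exceptional set for all the
averaging sets. -/
theorem ae_tendsto_average_smul_set (h : IsMeasurePreservingAction μ T)
    (herg : ∀ A : Set Ω, NullMeasurableSet A μ → (∀ x, T x ⁻¹' A =ᵐ[μ] A) → μ A = 0 ∨ μ A = 1)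
    {g : Ω → ℝ} (hg : Measurable g) {M : ℝ} (hM : ∀ ω, ‖g ω‖ ≤ M) :
    ∀ᵐ ω ∂μ, ∀ A : Set (Rd d), MeasurableSet A → Bornology.IsBounded A → 0 < volume A →
      Tendsto (fun t : ℝ => (t ^ d * volume.real A)⁻¹ * ∫ x in t • A, g (T x ω))
        atTop (𝓝 (∫ ω', g ω' ∂μ)) := by
  have hg2 : MemLp g 2 μ := MemLp.of_bound hg.aestronglyMeasurable M (ae_of_all _ hM)
  have hmax : ∀ᵐ ω ∂μ, ∀ k : ℕ, ∃ η ∈ convexHull ℝ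
      (Set.range fun (y : Rd d) (x : Rd d) => g (T (x + y) ω)),
      ∀ n : ℕ, 0 < n → ∫⁻ x in closedBall (0 : Rd d) n, ‖η x - ∫ ω', g ω' ∂μ‖ₑ ≤
        ENNReal.ofReal (1 / ((k : ℝ) + 1)) * volume (closedBall (0 : Rd d) n) :=
    ae_all_iff.2 fun k => h.ae_exists_mem_convexHull_maximal_le herg hg2 Nat.one_div_pos_of_nat
  filter_upwards [hmax, h.ae_aemeasurable_orbit] with ω hω hmeas A hA hA' hA0
  refine tendsto_average_smul_set (ψ := fun x => g (T x ω))
    (hg.comp_aemeasurable hmeas).aestronglyMeasurable (fun x => hM _) _ (fun ε hε => ?_) hA hA' hA0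
  obtain ⟨k, hk⟩ := exists_nat_one_div_lt hε
  obtain ⟨η, hη, hle⟩ := hω k
  exact ⟨η, hη, fun n hn => (hle n hn).trans (by gcongr)⟩

/-- Almost every point of a compact metric space is a typical trajectory of an ergodic action:
the exceptional set is the union of those of a countable dense family of continuous functions. -/
theorem ae_mem_typicalTrajectories {Ω : Type*} [MetricSpace Ω] [CompactSpace Ω]
    [MeasurableSpace Ω] [BorelSpace Ω] {μ : Measure Ω} [IsProbabilityMeasure μ]
    {T : Rd d → Ω → Ω} (h : IsMeasurePreservingAction μ T)
    (herg : ∀ A : Set Ω, NullMeasurableSet A μ → (∀ x, T x ⁻¹' A =ᵐ[μ] A) → μ A = 0 ∨ μ A = 1) :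
    ∀ᵐ ω ∂μ, ω ∈ typicalTrajectories μ T := by
  have hdense := ae_all_iff.2 fun k => h.ae_tendsto_average_smul_set herg
    (TopologicalSpace.denseSeq C(Ω, ℝ) k).continuous.measurable
    fun ω => (TopologicalSpace.denseSeq C(Ω, ℝ) k).norm_coe_le_norm ω
  filter_upwards [hdense, h.ae_aemeasurable_orbit] with ω hω hmeas g
  have hm : ∀ f : C(Ω, ℝ), AEStronglyMeasurable (fun x => f (T x ω)) volume := fun f =>
    (f.continuous.measurable.comp_aemeasurable hmeas).aestronglyMeasurable
  refine ⟨fun x => ⟨closedBall x 1, closedBall_mem_nhds x one_pos,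
    Measure.integrableOn_of_bounded measure_closedBall_lt_top.ne (hm g)
      (ae_of_all _ fun y => g.norm_coe_le_norm _)⟩, fun A hA hA' hA0 => ?_⟩
  rw [Metric.tendsto_nhds]
  intro ε hε
  obtain ⟨k, hk⟩ := (TopologicalSpace.denseRange_denseSeq C(Ω, ℝ)).exists_dist_lt g
    (show 0 < ε / 3 by positivity)
  set f := TopologicalSpace.denseSeq C(Ω, ℝ) k
  rw [dist_eq_norm] at hk
  have hfg : ∀ ω, ‖g ω - f ω‖ ≤ ‖g - f‖ := fun ω => (g - f).norm_coe_le_norm ω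
  have hi : ∀ u : C(Ω, ℝ), Integrable u μ := fun u =>
    Integrable.of_bound u.continuous.aestronglyMeasurable ‖u‖ (ae_of_all _ u.norm_coe_le_norm)
  have hE : ‖(∫ ω', g ω' ∂μ) - ∫ ω', f ω' ∂μ‖ < ε / 3 := by
    rw [← integral_sub (hi g) (hi f)]
    have := norm_integral_le_of_norm_le_const (ae_of_all μ hfg)
    rw [probReal_univ, mul_one] at this
    exact this.trans_lt hk
  filter_upwards [Metric.tendsto_nhds.1 (hω k A hA hA' hA0) (ε / 3) (by positivity),
    eventually_gt_atTop 0] with t h1 ht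
  have h2 := norm_average_smul_set_le hA' hA0 (fun x => hfg (T x ω)) ht
  rw [integral_sub (integrableOn_smul_set hA' (hm g) (fun x => g.norm_coe_le_norm _) t)
    (integrableOn_smul_set hA' (hm f) (fun x => f.norm_coe_le_norm _) t), mul_sub] at h2
  rw [Real.dist_eq, abs_lt] at h1 ⊢
  rw [Real.norm_eq_abs] at h2 hE
  have h2' := abs_lt.1 (h2.trans_lt hk)
  have hE' := abs_lt.1 hE
  constructor <;> linarith [h1.1, h1.2, h2'.1, h2'.2, hE'.1, hE'.2]

end IsMeasurePreservingAction

theorem mainTheorem6 {d : ℕ} {Ω : Type*} [MetricSpace Ω] [CompactSpace Ω]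
    [MeasurableSpace Ω] [BorelSpace Ω] (μ : Measure Ω) [IsProbabilityMeasure μ]
    (T : Rd d → Ω → Ω) (a : Rd d → Ω → Matrix (Fin d) (Fin d) ℝ)
    (h : IsStationaryErgodicField μ T a) :
    NullMeasurableSet (typicalTrajectories μ T) μ ∧ μ (typicalTrajectories μ T) = 1 := by
  have hae := h.isMeasurePreservingAction.ae_mem_typicalTrajectories
    fun A hA hinv => h.measure_eq_zero_or_one_of_preimage_ae_eq hA hinv
  have huniv : typicalTrajectories μ T =ᵐ[μ] Set.univ := eventuallyEq_univ.2 hae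
  exact ⟨nullMeasurableSet_univ.congr huniv.symm, by rw [measure_congr huniv, measure_univ]⟩
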